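/- Let $G$ be a finite connected simple graph and $X\subseteq V(G)$. Vertices $x,y$ of $G$ are $X$-visible if there is a shortest $x,y$-path in $G$ none of whose internal vertices belongs to $X$. The set $X$ is a dual mutual-visibility set of $G$ if any two vertices of $X$ are $X$-visible and any two vertices of $V(G)\setminus X$ are $X$-visible. Let $\mu_{\rm d}(G)$ be the largest cardinality of a dual mutual-visibility set of $G$. The dual visibility spectrum of $G$ is the vector $(r_0,r_1,\dots,r_k)$, where $k=\mu_{\rm d}(G)$ and $r_i$ is the number of dual mutual-visibility sets of $G$ of cardinality $i$. **Theorem.** For every integer $k\ge 0$ and all nonnegative integers $r_0,r_1,\dots,r_k$ with $r_0=1$ and $r_k>0$, there exists a finite connected simple graph $G$ such that $\mu_{\rm d}(G)=k$ and the dual visibility spectrum of $G$ is $(1,r_1,\dots,r_k)$. -/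

import Mathlib

namespace SimpleGraph

variable {V : Type*}

/-- `x` and `y` are `X`-visible in `G`: some shortest `x,y`-path has no internal vertex in `X`. -/
def XVisible (G : SimpleGraph V) (X : Finset V) (x y : V) : Prop :=
  ∃ p : G.Walk x y, p.IsPath ∧ p.length = G.dist x y ∧
    ∀ z ∈ p.support, z ≠ x → z ≠ y → z ∉ X

/-- `X` is a dual mutual-visibility set of `G`: any two vertices of `X`, and any two vertices
outside `X`, are `X`-visible. -/
def IsDualMutualVisibilitySet (G : SimpleGraph V) (X : Finset V) : Prop :=
  (∀ x ∈ X, ∀ y ∈ X, G.XVisible X x y) ∧ (∀ x ∉ X, ∀ y ∉ X, G.XVisible X x y)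

open Classical in
/-- The finite family of all dual mutual-visibility sets of a finite graph. -/
noncomputable def dualMutualVisibilitySets [Fintype V] (G : SimpleGraph V) :
    Finset (Finset V) :=
  Finset.univ.filter fun X => G.IsDualMutualVisibilitySet X

/-- The dual mutual-visibility number `μ_d(G)`: the largest cardinality of a dual
mutual-visibility set. -/
noncomputable def dualMutualVisibilityNumber [Fintype V] (G : SimpleGraph V) : ℕ :=
  G.dualMutualVisibilitySets.sup Finset.card

/-- The number of dual mutual-visibility sets of size `i`. -/
noncomputable def dualVisibilityCount [Fintype V] (G : SimpleGraph V) (i : ℕ) : ℕ :=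
  (G.dualMutualVisibilitySets.filter fun X => X.card = i).card

/-- The dual visibility spectrum `(r_0, …, r_k)`, where `k = μ_d(G)` and `r_i` is the number of
dual mutual-visibility sets of size `i`, as a list of length `k + 1`. -/
noncomputable def dualVisibilitySpectrum [Fintype V] (G : SimpleGraph V) : List ℕ :=
  List.ofFn fun i : Fin (G.dualMutualVisibilityNumber + 1) => G.dualVisibilityCount i

end SimpleGraph

/-!
A vertex `v` with three pairwise non-adjacent neighbours whose pairwise only common neighbour is `v`
lies in no dual mutual-visibility set `X`: two of the neighbours are on the same side of `X`, and
`v` is the middle of their only shortest path. All vertices of the Petersen graph are of this kind,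
so attaching a copy of it to a vertex keeps that vertex out of every dual mutual-visibility set.

Start from a disjoint union of cliques, the *blocks*, `r i` of them of size `i`. Vertices protected
in this way are added so that every `X` contains a block entirely or not at all (each element gets a
private neighbour) and contains no two elements `a`, `b` of different blocks (these become the only
common neighbours of two new vertices). Further protected vertices provide detours around each
block, so that every block is itself a dual mutual-visibility set.
-/

open SimpleGraph

namespace DualVisibility

section Visibility

variable {V : Type*} {G : SimpleGraph V} {X : Finset V} {x y : V}

theorem xVisible_of_length_eq_dist (p : G.Walk x y) (hp : p.length = G.dist x y)
    (hX : ∀ z ∈ p.support, z ≠ x → z ≠ y → z ∉ X) : G.XVisible X x y :=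
  ⟨p, p.isPath_of_length_eq_dist hp, hp, hX⟩

theorem xVisible_of_adj (h : G.Adj x y) : G.XVisible X x y :=
  xVisible_of_length_eq_dist h.toWalk (by simp [dist_eq_one_iff_adj.2 h]) (by simp)

theorem xVisible_refl (x : V) : G.XVisible X x x :=
  xVisible_of_length_eq_dist .nil (by simp) (by simp)

theorem exists_commonNeighbor_notMem_of_xVisible (h : G.XVisible X x y) (hne : x ≠ y)
    (hadj : ¬ G.Adj x y) (hc : (G.commonNeighbors x y).Nonempty) :
    ∃ z ∈ G.commonNeighbors x y, z ∉ X := by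
  obtain ⟨p, -, hlen, hX⟩ := h
  obtain ⟨v, hxv, hyv⟩ := hc
  have hle : p.length ≤ 2 := hlen ▸ dist_le (.cons hxv (.cons hyv.symm .nil))
  match p, hle, hX with
  | .nil, _, _ => exact absurd rfl hne
  | .cons hxy .nil, _, _ => exact absurd hxy hadj
  | .cons (v := z) hxz (.cons hzy .nil), _, hX =>
    exact ⟨z, ⟨hxz, hzy.symm⟩, hX z (by simp) hxz.ne' hzy.ne⟩
  | .cons _ (.cons _ (.cons _ _)), hle, _ => simp at hle

theorem notMem_of_claw (hX : G.IsDualMutualVisibilitySet X) {v : V} {s : Finset V}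
    (hs : 2 < s.card) (hindep : G.IsIndepSet s)
    (hcommon : (s : Set V).Pairwise fun y z => G.commonNeighbors y z = {v}) : v ∉ X := by
  classical
  intro hv
  obtain ⟨y, hy, z, hz, hyz, hside⟩ :
      ∃ y ∈ s, ∃ z ∈ s, y ≠ z ∧ decide (y ∈ X) = decide (z ∈ X) :=
    Finset.exists_ne_map_eq_of_card_lt_of_maps_to (t := .univ) (by simpa using hs)
      fun _ _ => Finset.mem_univ _
  have hvis : G.XVisible X y z := by
    by_cases h : y ∈ X
    · exact hX.1 y h z (by simpa [h] using hside)
    · exact hX.2 y h z (by simpa [h] using hside)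
  obtain ⟨w, hw, hwX⟩ := exists_commonNeighbor_notMem_of_xVisible hvis hyz (hindep hy hz hyz)
    (by simp [hcommon hy hz hyz])
  rw [hcommon hy hz hyz, Set.mem_singleton_iff] at hw
  exact hwX (hw ▸ hv)

/-- The set `X` can be bypassed: any two distinct vertices outside `X` that have neighbours in `X`
have a common neighbour outside `X`. This makes walks between vertices outside `X` replaceable by
walks that avoid `X` and are no longer. -/
def HasDetours (G : SimpleGraph V) (X : Finset V) : Prop :=
  ∀ ⦃x⦄, x ∉ X → ∀ ⦃y⦄, y ∉ X → x ≠ y → (∃ a ∈ X, G.Adj x a) → (∃ b ∈ X, G.Adj y b) →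
    ∃ z ∈ G.commonNeighbors x y, z ∉ X

/-- The second part is what the induction needs once the walk has entered `X`: `x` is then the last
vertex before `X`. -/
theorem HasDetours.exists_walk_avoiding (hX : HasDetours G X) {z y : V} (p : G.Walk z y)
    (hy : y ∉ X) :
    (z ∉ X → ∃ q : G.Walk z y, q.length ≤ p.length ∧ ∀ u ∈ q.support, u ∉ X) ∧
    (z ∈ X → ∀ x ∉ X, (∃ a ∈ X, G.Adj x a) →
      ∃ q : G.Walk x y, q.length ≤ p.length + 1 ∧ ∀ u ∈ q.support, u ∉ X) := by
  induction p with
  | nil => exact ⟨fun _ => ⟨.nil, by simp, by simpa using hy⟩, fun h => absurd h hy⟩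
  | @cons z z' y hzz' p ih =>
    obtain ⟨ih_out, ih_in⟩ := ih hy
    by_cases hz' : z' ∈ X
    · refine ⟨fun hz => ih_in hz' z hz ⟨z', hz', hzz'⟩, fun _ x hx hxX => ?_⟩
      obtain ⟨q, hq, hqX⟩ := ih_in hz' x hx hxX
      exact ⟨q, hq.trans (by simp), hqX⟩
    · obtain ⟨q, hq, hqX⟩ := ih_out hz'
      refine ⟨fun hz => ⟨.cons hzz' q, by simpa using hq, by simpa [hz] using hqX⟩,
        fun hz x hx hxX => ?_⟩
      obtain rfl | hne := eq_or_ne x z'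
      · exact ⟨q, hq.trans (by simp [add_assoc]), hqX⟩
      · obtain ⟨m, ⟨(hxm : G.Adj x m), (hzm : G.Adj z' m)⟩, hm⟩ :=
          hX hx hz' hne hxX ⟨z, hz, hzz'.symm⟩
        exact ⟨.cons hxm (.cons hzm.symm q), by simpa using hq, by simpa [hx, hm] using hqX⟩

theorem HasDetours.isDualMutualVisibilitySet (hX : HasDetours G X) (hG : G.Connected)
    (hclique : G.IsClique X) : G.IsDualMutualVisibilitySet X := by
  refine ⟨fun x hx y hy => ?_, fun x hx y hy => ?_⟩
  · obtain rfl | hne := eq_or_ne x y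
    · exact xVisible_refl x
    · exact xVisible_of_adj (hclique hx hy hne)
  · obtain ⟨p, hp⟩ := hG.exists_walk_length_eq_dist x y
    obtain ⟨q, hq, hqX⟩ := (hX.exists_walk_avoiding p hy).1 hx
    exact xVisible_of_length_eq_dist q (le_antisymm (hp ▸ hq) (dist_le q)) fun z hz _ _ => hqX z hz

end Visibility

section StronglyRegular

variable {W : Type*} [Fintype W] {P : SimpleGraph W} [DecidableRel P.Adj] {n d ℓ μ : ℕ}

theorem isIndepSet_neighborFinset (hP : P.IsSRGWith n d 0 μ) (x : W) :
    P.IsIndepSet (P.neighborFinset x) := by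
  intro y hy z hz _ hyz
  rw [Finset.mem_coe, mem_neighborFinset] at hy hz
  have : IsEmpty (P.commonNeighbors y z) := Fintype.card_eq_zero_iff.1 (hP.of_adj y z hyz)
  exact this.false ⟨x, hy.symm, hz.symm⟩

theorem commonNeighbors_eq_singleton (hP : P.IsSRGWith n d 0 1) (x : W) :
    (P.neighborFinset x : Set W).Pairwise fun y z => P.commonNeighbors y z = {x} := by
  intro y hy z hz hyz
  have hadj := isIndepSet_neighborFinset hP x hy hz hyz
  rw [Finset.mem_coe, mem_neighborFinset] at hy hz
  have : Subsingleton (P.commonNeighbors y z) :=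
    Fintype.card_le_one_iff_subsingleton.1 (hP.of_not_adj hyz hadj).le
  exact (Set.subsingleton_coe _).1 this |>.eq_singleton_of_mem ⟨hy.symm, hz.symm⟩

theorem preconnected_of_isSRGWith (hP : P.IsSRGWith n d ℓ μ) (hμ : 0 < μ) : P.Preconnected := by
  intro x y
  by_cases hxy : x = y
  · exact hxy ▸ .rfl
  by_cases hadj : P.Adj x y
  · exact hadj.reachable
  · obtain ⟨z, hxz, hyz⟩ : Nonempty (P.commonNeighbors x y) :=
      Fintype.card_pos_iff.1 (hP.of_not_adj hxy hadj ▸ hμ)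
    exact hxz.reachable.trans hyz.symm.reachable

/-- The Petersen graph, as the Kneser graph of the two-element subsets of a five-element set. -/
def petersen : SimpleGraph {s : Finset (Fin 5) // s.card = 2} where
  Adj s t := Disjoint s.1 t.1
  symm := ⟨fun _ _ h => h.symm⟩
  loopless := ⟨fun s h => by simpa [disjoint_self.1 h] using s.2⟩

instance : DecidableRel petersen.Adj := fun s t => inferInstanceAs (Decidable (Disjoint s.1 t.1))

set_option maxRecDepth 10000 in
theorem petersen_isSRGWith : petersen.IsSRGWith 10 3 0 1 where
  card := by decide
  regular := by unfold IsRegularOfDegree; decide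
  of_adj := by decide
  of_not_adj := by unfold Pairwise; decide

theorem petersen_preconnected : petersen.Preconnected :=
  preconnected_of_isSRGWith petersen_isSRGWith one_pos

end StronglyRegular

section Shield

variable {A B W : Type*} {H : SimpleGraph (A ⊕ B)} {P : SimpleGraph W} {w : W}

/-- The inclusion of the vertices of `H` into those of `shield H P w`. -/
abbrev core (w : W) : A ⊕ B ↪ A ⊕ B × W := .sumMap (.refl A) (.sectL B w)

/-- The inclusion of the copy of `P` at `b` into `shield H P w`. -/
abbrev gadget (b : B) : W ↪ A ⊕ B × W := (Function.Embedding.sectR b W).trans .inr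

/-- The graph `H` with a copy of `P` attached at each vertex `b : B`, by identifying `b` with the
vertex `w` of the copy. For suitable `P` this keeps `B` and the copies out of all dual
mutual-visibility sets. -/
def shield (H : SimpleGraph (A ⊕ B)) (P : SimpleGraph W) (w : W) : SimpleGraph (A ⊕ B × W) :=
  H.map (core w) ⊔ ⨆ b, P.map (gadget b)

theorem shield_adj {u v : A ⊕ B × W} : (shield H P w).Adj u v ↔
    (∃ x y, H.Adj x y ∧ core w x = u ∧ core w y = v) ∨
      ∃ b x y, P.Adj x y ∧ gadget b x = u ∧ gadget b y = v := by
  simp only [shield, sup_adj, iSup_adj, SimpleGraph.map_adj]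

theorem shield_adj_core {x y : A ⊕ B} :
    (shield H P w).Adj (core w x) (core w y) ↔ H.Adj x y := by
  refine shield_adj.trans ⟨?_, fun h => .inl ⟨x, y, h, rfl, rfl⟩⟩
  rintro (⟨x', y', h, hx, hy⟩ | ⟨b, x', y', h, hx, hy⟩)
  · rwa [(core w).injective hx, (core w).injective hy] at h
  · cases x <;> cases y <;> simp_all

theorem shield_adj_gadget {b : B} {x y : W} :
    (shield H P w).Adj (gadget b x) (gadget b y) ↔ P.Adj x y := by
  refine shield_adj.trans ⟨?_, fun h => .inr ⟨b, x, y, h, rfl, rfl⟩⟩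
  rintro (⟨x', y', h, hx, hy⟩ | ⟨b', x', y', h, hx, hy⟩)
  · cases x' <;> cases y' <;> simp_all
  · simp_all

theorem exists_eq_gadget_of_adj {b : B} {x : W} (hx : x ≠ w) {z : A ⊕ B × W}
    (h : (shield H P w).Adj (gadget b x) z) : ∃ y, gadget b y = z := by
  obtain ⟨u, -, -, hu, -⟩ | ⟨b', x', y, -, hx', rfl⟩ := shield_adj.1 h
  · cases u <;> simp_all
  · obtain rfl : b' = b := by simp_all
    exact ⟨y, rfl⟩

theorem exists_eq_core_or_exists_eq_gadget (w : W) (z : A ⊕ B × W) :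
    (∃ x, core w x = z) ∨ ∃ b, ∃ x ≠ w, gadget b x = z := by
  obtain a | ⟨b, x⟩ := z
  · exact .inl ⟨.inl a, rfl⟩
  · obtain rfl | hx := eq_or_ne x w
    · exact .inl ⟨.inr b, rfl⟩
    · exact .inr ⟨b, x, hx, rfl⟩

theorem eq_inr_of_adj_core_gadget {b : B} {x : W} (hx : x ≠ w) {u : A ⊕ B}
    (h : (shield H P w).Adj (core w u) (gadget b x)) : u = .inr b := by
  obtain ⟨y, hy⟩ := exists_eq_gadget_of_adj hx h.symm
  cases u <;> simp_all

theorem commonNeighbors_shield_core {u v : A ⊕ B} (huv : u ≠ v) :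
    (shield H P w).commonNeighbors (core w u) (core w v) = core w '' H.commonNeighbors u v := by
  ext z
  simp only [mem_commonNeighbors, Set.mem_image]
  constructor
  · rintro ⟨hu, hv⟩
    obtain ⟨x, rfl⟩ | ⟨b, x, hx, rfl⟩ := exists_eq_core_or_exists_eq_gadget w z
    · exact ⟨x, ⟨shield_adj_core.1 hu, shield_adj_core.1 hv⟩, rfl⟩
    · exact absurd
        ((eq_inr_of_adj_core_gadget hx hu).trans (eq_inr_of_adj_core_gadget hx hv).symm) huv
  · rintro ⟨x, ⟨hu, hv⟩, rfl⟩
    exact ⟨shield_adj_core.2 hu, shield_adj_core.2 hv⟩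

theorem commonNeighbors_shield_gadget {b : B} {x y : W} (hxy : x ≠ y) :
    (shield H P w).commonNeighbors (gadget b x) (gadget b y) =
      gadget b '' P.commonNeighbors x y := by
  ext z
  simp only [mem_commonNeighbors, Set.mem_image]
  constructor
  · rintro ⟨hx, hy⟩
    obtain ⟨z, rfl⟩ : ∃ z', gadget b z' = z := by
      obtain hxw | hyw : x ≠ w ∨ y ≠ w := by grind
      · exact exists_eq_gadget_of_adj hxw hx
      · exact exists_eq_gadget_of_adj hyw hy
    exact ⟨z, ⟨shield_adj_gadget.1 hx, shield_adj_gadget.1 hy⟩, rfl⟩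
  · rintro ⟨z, ⟨hx, hy⟩, rfl⟩
    exact ⟨shield_adj_gadget.2 hx, shield_adj_gadget.2 hy⟩

theorem shield_connected (hH : H.Connected) (hP : P.Preconnected) : (shield H P w).Connected := by
  let coreHom : H →g shield H P w := ⟨core w, shield_adj_core.2⟩
  let gadgetHom (b : B) : P →g shield H P w := ⟨gadget b, shield_adj_gadget.2⟩
  have reachable_core (z : A ⊕ B × W) : ∃ x, (shield H P w).Reachable (core w x) z := by
    obtain a | ⟨b, x⟩ := z
    · exact ⟨.inl a, .rfl⟩
    · exact ⟨.inr b, (hP w x).map (gadgetHom b)⟩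
  have := hH.nonempty.map (core w)
  refine ⟨fun z z' => ?_⟩
  obtain ⟨x, hx⟩ := reachable_core z
  obtain ⟨x', hx'⟩ := reachable_core z'
  exact hx.symm.trans (((hH.preconnected x x').map coreHom).trans hx')

theorem exists_eq_map_inl_of_isDualMutualVisibilitySet [Fintype W] [DecidableRel P.Adj] {n d : ℕ}
    (hP : P.IsSRGWith n d 0 1) (hd : 2 < d) {X : Finset (A ⊕ B × W)}
    (hX : (shield H P w).IsDualMutualVisibilitySet X) : ∃ Y : Finset A, X = Y.map .inl := by
  have hgadget (b : B) (x : W) : gadget b x ∉ X := by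
    refine notMem_of_claw hX (s := (P.neighborFinset x).map (gadget b)) ?_ ?_ ?_
    · simpa [hP.regular.degree_eq x] using hd
    · rw [Finset.coe_map, IsIndepSet, (gadget b).injective.injOn.pairwise_image]
      exact fun y hy z hz hyz h =>
        isIndepSet_neighborFinset hP x hy hz hyz (shield_adj_gadget.1 h)
    · rw [Finset.coe_map, (gadget b).injective.injOn.pairwise_image]
      intro y hy z hz hyz
      simp only [Function.onFun, commonNeighbors_shield_gadget hyz,
        commonNeighbors_eq_singleton hP x hy hz hyz, Set.image_singleton]
  refine ⟨X.toLeft, Finset.ext fun z => ?_⟩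
  obtain a | ⟨b, x⟩ := z
  · simp
  · simpa using hgadget b x

variable {Y : Finset A}

theorem core_mem_map_inl {x : A ⊕ B} :
    core w x ∈ Y.map .inl ↔ x ∈ Y.map .inl := by
  cases x <;> simp

theorem exists_commonNeighbor_notMem_of_shield
    (hY : (shield H P w).IsDualMutualVisibilitySet (Y.map .inl)) {x y : A ⊕ B}
    (hx : x ∉ Y.map .inl) (hy : y ∉ Y.map .inl) (hxy : x ≠ y) (hadj : ¬ H.Adj x y)
    (hc : (H.commonNeighbors x y).Nonempty) : ∃ z ∈ H.commonNeighbors x y, z ∉ Y.map .inl := by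
  have hvis : (shield H P w).XVisible (Y.map .inl) (core w x) (core w y) :=
    hY.2 _ (core_mem_map_inl.not.2 hx) _ (core_mem_map_inl.not.2 hy)
  obtain ⟨_, hz, hzY⟩ := exists_commonNeighbor_notMem_of_xVisible hvis
    ((core w).injective.ne hxy) (shield_adj_core.not.2 hadj)
    (commonNeighbors_shield_core hxy ▸ hc.image _)
  rw [commonNeighbors_shield_core hxy] at hz
  obtain ⟨z, hz, rfl⟩ := hz
  exact ⟨z, hz, core_mem_map_inl.not.1 hzY⟩

theorem isDualMutualVisibilitySet_shield (hH : H.Connected) (hP : P.Preconnected)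
    (hclique : H.IsClique (Y.map .inl : Finset (A ⊕ B))) (hdet : HasDetours H (Y.map .inl)) :
    (shield H P w).IsDualMutualVisibilitySet (Y.map .inl) := by
  have hcore {z} (hz : z ∉ Y.map .inl) (h : ∃ a ∈ Y.map .inl, (shield H P w).Adj z a) :
      ∃ x ∉ Y.map .inl, core w x = z ∧ ∃ a ∈ Y.map .inl, H.Adj x a := by
    obtain ⟨_, ha, hza⟩ := h
    obtain ⟨a, haY, rfl⟩ := Finset.mem_map.1 ha
    obtain ⟨x, rfl⟩ | ⟨b, x, hx, rfl⟩ := exists_eq_core_or_exists_eq_gadget w z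
    · exact ⟨x, core_mem_map_inl.not.1 hz, rfl, .inl a, Finset.mem_map_of_mem _ haY,
        shield_adj_core.1 hza⟩
    · exact absurd (eq_inr_of_adj_core_gadget (u := .inl a) hx hza.symm) (by simp)
  refine HasDetours.isDualMutualVisibilitySet ?_ (shield_connected hH hP) ?_
  · intro z hz z' hz' hne hzY hzY'
    obtain ⟨x, hx, rfl, hxY⟩ := hcore hz hzY
    obtain ⟨y, hy, rfl, hyY⟩ := hcore hz' hzY'
    have hxy : x ≠ y := fun h => hne (h ▸ rfl)
    obtain ⟨m, hm, hmY⟩ := hdet hx hy hxy hxY hyY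
    exact ⟨core w m, commonNeighbors_shield_core hxy ▸ Set.mem_image_of_mem _ hm,
      core_mem_map_inl.not.2 hmY⟩
  · rw [Finset.coe_map, isClique_iff, Function.Embedding.inl.injective.injOn.pairwise_image]
      at hclique ⊢
    exact fun a ha b hb hab => shield_adj_core.2 (hclique ha hb hab)

end Shield

section BlockGraph

variable {A ι : Type*} {f : A → ι}

/-- The vertices added to the elements of the blocks: a *probe* for each pair of elements, which
restricts the dual mutual-visibility sets containing them, a *hub* for each pair of probes, which
provides a detour between these, and a center, which makes the graph connected. -/
inductive Guard (A : Type*) : Type _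
  | center : Guard A
  | probe : A × A → Guard A
  | hub : A × A → A × A → Guard A
  deriving Fintype

/-- The two probes `(a, b)` and `(b, a)` of elements in different blocks. They are denied a common
hub, so that `a` and `b` are their only common neighbours. -/
def IsTwin (f : A → ι) (u v : A × A) : Prop :=
  v = u.swap ∧ f u.1 ≠ f u.2

/-- The edges of `blockGraph f`, up to orientation and loops. -/
def Link (f : A → ι) : A ⊕ Guard A → A ⊕ Guard A → Prop
  | .inl a, .inl b => f a = f b
  | .inl a, .inr (.probe u) => a = u.1 ∨ a = u.2
  | .inr (.probe p), .inr (.hub u v) => (p = u ∨ p = v) ∧ ¬ IsTwin f u v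
  | .inr (.hub _ _), .inr .center => True
  | _, _ => False

/-- The graph on the elements and the guards in which the fibres of `f` are the blocks. -/
def blockGraph (f : A → ι) : SimpleGraph (A ⊕ Guard A) := .fromRel (Link f)

theorem blockGraph_adj_inl_inl {a b : A} :
    (blockGraph f).Adj (.inl a) (.inl b) ↔ a ≠ b ∧ f a = f b := by
  simp [blockGraph, Link, eq_comm]

theorem blockGraph_adj_inl_probe {a : A} {u : A × A} :
    (blockGraph f).Adj (.inl a) (.inr (.probe u)) ↔ a = u.1 ∨ a = u.2 := by
  simp [blockGraph, Link]

theorem blockGraph_adj_probe_hub {p u v : A × A} :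
    (blockGraph f).Adj (.inr (.probe p)) (.inr (.hub u v)) ↔ (p = u ∨ p = v) ∧ ¬ IsTwin f u v := by
  simp [blockGraph, Link]

theorem blockGraph_not_adj_probe_probe {u v : A × A} :
    ¬ (blockGraph f).Adj (.inr (.probe u)) (.inr (.probe v)) := by
  simp [blockGraph, Link]

theorem commonNeighbors_inl_probe_self {a s : A} (has : a ≠ s) (hf : f a = f s) :
    (blockGraph f).commonNeighbors (.inl a) (.inr (.probe (s, s))) = {.inl s} := by
  ext (b | _ | p | ⟨u, v⟩) <;>
    simp only [mem_commonNeighbors, blockGraph, fromRel_adj, Link] <;> grind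

theorem commonNeighbors_probe_swap {u : A × A} (hu : f u.1 ≠ f u.2) :
    (blockGraph f).commonNeighbors (.inr (.probe u)) (.inr (.probe u.swap)) =
      {.inl u.1, .inl u.2} := by
  ext (b | _ | p | ⟨v, v'⟩) <;>
    simp only [mem_commonNeighbors, blockGraph, fromRel_adj, Link, IsTwin] <;> grind

theorem hub_mem_commonNeighbors {u v : A × A} (huv : ¬ IsTwin f u v) :
    .inr (.hub u v) ∈ (blockGraph f).commonNeighbors (.inr (.probe u)) (.inr (.probe v)) :=
  ⟨blockGraph_adj_probe_hub.2 ⟨.inl rfl, huv⟩, blockGraph_adj_probe_hub.2 ⟨.inr rfl, huv⟩⟩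

theorem blockGraph_connected : (blockGraph f).Connected := by
  rw [connected_iff_exists_forall_reachable]
  refine ⟨.inr .center, fun x => .symm ?_⟩
  have hhub (u v : A × A) :
      (blockGraph f).Reachable (.inr (.hub u v)) (.inr .center) :=
    Adj.reachable (by simp [blockGraph, Link])
  have hprobe (u : A × A) :
      (blockGraph f).Reachable (.inr (.probe u)) (.inr .center) := by
    have hself : ¬ IsTwin f u u := by grind [IsTwin]
    exact (blockGraph_adj_probe_hub.2 ⟨.inl rfl, hself⟩).reachable.trans (hhub u u)
  obtain a | _ | u | ⟨u, v⟩ := x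
  · exact (blockGraph_adj_inl_probe (u := (a, a)).2 (.inl rfl)).reachable.trans (hprobe _)
  · exact .rfl
  · exact hprobe u
  · exact hhub u v

variable {Y : Finset A}

theorem isClique_blockGraph (hY : ∀ a ∈ Y, ∀ b ∈ Y, f a = f b) :
    (blockGraph f).IsClique (Y.map .inl : Finset (A ⊕ Guard A)) := by
  rw [Finset.coe_map, isClique_iff, Function.Embedding.inl.injective.injOn.pairwise_image]
  exact fun a ha b hb hab => blockGraph_adj_inl_inl.2 ⟨hab, hY a ha b hb⟩

theorem hasDetours_blockGraph (hY : ∀ a ∈ Y, ∀ b, b ∈ Y ↔ f b = f a) :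
    HasDetours (blockGraph f) (Y.map .inl) := by
  have exists_eq_probe {x} (hx : x ∉ Y.map .inl)
      (h : ∃ a ∈ Y.map .inl, (blockGraph f).Adj x a) : ∃ u, x = .inr (.probe u) := by
    obtain ⟨_, ha, hxa⟩ := h
    obtain ⟨a, haY, rfl⟩ := Finset.mem_map.1 ha
    obtain b | _ | u | ⟨u, v⟩ := x
    · have hb : b ∈ Y := (hY a haY b).2 (blockGraph_adj_inl_inl.1 hxa).2
      exact absurd (Finset.mem_map_of_mem _ hb) hx
    · simp [blockGraph, Link] at hxa
    · exact ⟨u, rfl⟩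
    · simp [blockGraph, Link] at hxa
  intro x hx y hy _ hxY hyY
  obtain ⟨u, rfl⟩ := exists_eq_probe hx hxY
  obtain ⟨v, rfl⟩ := exists_eq_probe hy hyY
  by_cases huv : IsTwin f u v
  · obtain ⟨rfl, hne⟩ := huv
    have hside : u.1 ∉ Y ∨ u.2 ∉ Y := by grind
    rw [commonNeighbors_probe_swap hne]
    obtain h | h := hside
    · exact ⟨.inl u.1, by simp, by simpa using h⟩
    · exact ⟨.inl u.2, by simp, by simpa using h⟩
  · exact ⟨_, hub_mem_commonNeighbors huv, by simp⟩

/-- The elements of the blocks, and a copy of the Petersen graph for each guard. -/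
abbrev Vertex (A : Type*) : Type _ := A ⊕ Guard A × {s : Finset (Fin 5) // s.card = 2}

/-- The graph whose dual mutual-visibility sets are the empty set and the fibres of `f`: the guards
of `blockGraph f` are shielded by Petersen graphs. -/
def shieldedBlockGraph (f : A → ι) : SimpleGraph (Vertex A) :=
  shield (blockGraph f) petersen ⟨{0, 1}, rfl⟩

theorem shieldedBlockGraph_connected : (shieldedBlockGraph f).Connected :=
  shield_connected blockGraph_connected petersen_preconnected

theorem mem_of_block_eq_of_mem (hY : (shieldedBlockGraph f).IsDualMutualVisibilitySet (Y.map .inl))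
    {a s : A} (hs : s ∈ Y) (hf : f a = f s) : a ∈ Y := by
  by_contra ha
  have has : a ≠ s := fun h => ha (h ▸ hs)
  obtain ⟨z, hz, hzY⟩ := exists_commonNeighbor_notMem_of_shield hY
    (x := .inl a) (y := .inr (.probe (s, s))) (by simpa using ha) (by simp) (by simp)
    (by simpa [blockGraph_adj_inl_probe] using has)
    (by simp [commonNeighbors_inl_probe_self has hf])
  rw [commonNeighbors_inl_probe_self has hf, Set.mem_singleton_iff] at hz
  exact hzY (hz ▸ Finset.mem_map_of_mem _ hs)

theorem block_eq_of_mem_of_mem (hY : (shieldedBlockGraph f).IsDualMutualVisibilitySet (Y.map .inl))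
    {a b : A} (ha : a ∈ Y) (hb : b ∈ Y) : f a = f b := by
  by_contra hab
  have hcommon : (blockGraph f).commonNeighbors (.inr (.probe (a, b))) (.inr (.probe (b, a))) =
      {.inl a, .inl b} := commonNeighbors_probe_swap hab
  obtain ⟨z, hz, hzY⟩ := exists_commonNeighbor_notMem_of_shield hY
    (x := .inr (.probe (a, b))) (y := .inr (.probe (b, a))) (by simp) (by simp) (by grind)
    blockGraph_not_adj_probe_probe (hcommon ▸ Set.insert_nonempty _ _)
  rw [hcommon] at hz
  obtain rfl | rfl := hz
  · exact hzY (Finset.mem_map_of_mem _ ha)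
  · exact hzY (Finset.mem_map_of_mem _ hb)

theorem isDualMutualVisibilitySet_shieldedBlockGraph_iff :
    (shieldedBlockGraph f).IsDualMutualVisibilitySet (Y.map .inl) ↔
      ∀ a ∈ Y, ∀ b, b ∈ Y ↔ f b = f a := by
  refine ⟨fun hY a ha b =>
    ⟨fun hb => block_eq_of_mem_of_mem hY hb ha, mem_of_block_eq_of_mem hY ha⟩,
    fun hY => ?_⟩
  exact isDualMutualVisibilitySet_shield blockGraph_connected
    petersen_preconnected
    (isClique_blockGraph fun a ha b hb => (hY b hb a).1 ha) (hasDetours_blockGraph hY)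

end BlockGraph

section Spectrum

theorem dualVisibilitySpectrum_eq_ofFn {V : Type*} [Fintype V] {G : SimpleGraph V} {k : ℕ}
    {r : Fin (k + 1) → ℕ} (hk : G.dualMutualVisibilityNumber = k)
    (hr : ∀ i : Fin (k + 1), G.dualVisibilityCount i = r i) :
    G.dualVisibilitySpectrum = List.ofFn r := by
  subst hk
  simp only [dualVisibilitySpectrum, hr]

variable {k : ℕ} {r : Fin (k + 1) → ℕ}

/-- The index set of the blocks, `r i` of them of size `i` for each `i`. -/
abbrev BlockIndex (r : Fin (k + 1) → ℕ) : Type := Σ i, Fin (r i)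

/-- The disjoint union of the blocks. -/
abbrev Element (r : Fin (k + 1) → ℕ) : Type := Σ j : BlockIndex r, Fin j.1

/-- The graph realizing the spectrum `r`. -/
abbrev spectrumGraph (r : Fin (k + 1) → ℕ) : SimpleGraph (Vertex (Element r)) :=
  shieldedBlockGraph (Sigma.fst : Element r → BlockIndex r)

/-- The block with index `j`. -/
def block (j : BlockIndex r) : Finset (Element r) :=
  Finset.univ.map (.sigmaMk j)

theorem mem_block {j : BlockIndex r} {a : Element r} : a ∈ block j ↔ a.1 = j := by
  obtain ⟨j', x⟩ := a
  simp only [block, Finset.mem_map, Finset.mem_univ, true_and]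
  constructor
  · rintro ⟨y, h⟩
    exact (congrArg Sigma.fst h).symm
  · rintro rfl
    exact ⟨x, rfl⟩

theorem card_block (j : BlockIndex r) : (block j).card = j.1 := by
  simp [block]

theorem block_injective (hr0 : r 0 = 1) : Function.Injective (block (r := r)) := by
  intro j j' h
  obtain hempty | ⟨a, ha⟩ := (block j).eq_empty_or_nonempty
  · have hj : j.1 = 0 := Fin.ext (by simp [← card_block, hempty])
    have hj' : j'.1 = 0 := Fin.ext (by simp [← card_block, ← h, hempty])
    obtain ⟨_, x⟩ := j
    obtain ⟨_, x'⟩ := j'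
    subst hj hj'
    have : Subsingleton (Fin (r 0)) := by rw [hr0]; infer_instance
    rw [Subsingleton.elim x x']
  · exact (mem_block.1 ha).symm.trans (mem_block.1 (h ▸ ha))

/-- The block with index `j`, as a set of vertices of `spectrumGraph r`. -/
def blockEmbedding (hr0 : r 0 = 1) : BlockIndex r ↪ Finset (Vertex (Element r)) :=
  ⟨_, (Finset.map_injective .inl).comp (block_injective hr0)⟩

theorem exists_block_eq_iff (hr0 : r 0 = 1) {Y : Finset (Element r)} :
    (∃ j, block j = Y) ↔ ∀ a ∈ Y, ∀ b, b ∈ Y ↔ b.1 = a.1 := by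
  constructor
  · rintro ⟨j, rfl⟩ a ha b
    rw [mem_block, mem_block.1 ha]
  · intro hY
    obtain rfl | ⟨a, ha⟩ := Y.eq_empty_or_nonempty
    · exact ⟨⟨0, 0, by omega⟩, Finset.card_eq_zero.1 (card_block _)⟩
    · exact ⟨a.1, Finset.ext fun b => mem_block.trans (hY a ha b).symm⟩

theorem dualMutualVisibilitySets_spectrumGraph (hr0 : r 0 = 1) :
    (spectrumGraph r).dualMutualVisibilitySets = Finset.univ.map (blockEmbedding hr0) := by
  ext X
  simp only [dualMutualVisibilitySets, Finset.mem_filter, Finset.mem_map, Finset.mem_univ,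
    true_and]
  constructor
  · intro hX
    obtain ⟨Y, rfl⟩ :=
      exists_eq_map_inl_of_isDualMutualVisibilitySet petersen_isSRGWith (by decide) hX
    obtain ⟨j, rfl⟩ := (exists_block_eq_iff hr0).2
      (isDualMutualVisibilitySet_shieldedBlockGraph_iff.1 hX)
    exact ⟨j, rfl⟩
  · rintro ⟨j, rfl⟩
    exact isDualMutualVisibilitySet_shieldedBlockGraph_iff.2
      ((exists_block_eq_iff hr0).1 ⟨j, rfl⟩)

theorem card_blockEmbedding (hr0 : r 0 = 1) (j : BlockIndex r) :
    (blockEmbedding hr0 j).card = j.1 :=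
  (Finset.card_map _).trans (card_block j)

theorem dualMutualVisibilityNumber_spectrumGraph (hr0 : r 0 = 1) (hrk : 0 < r (Fin.last k)) :
    (spectrumGraph r).dualMutualVisibilityNumber = k := by
  rw [dualMutualVisibilityNumber, dualMutualVisibilitySets_spectrumGraph hr0, Finset.sup_map]
  simp only [Function.comp_def, card_blockEmbedding]
  refine le_antisymm (Finset.sup_le fun j _ => j.1.is_le) ?_
  exact Finset.le_sup (f := fun j : BlockIndex r => (j.1 : ℕ))
    (Finset.mem_univ ⟨Fin.last k, 0, hrk⟩)

theorem dualVisibilityCount_spectrumGraph (hr0 : r 0 = 1) (i : Fin (k + 1)) :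
    (spectrumGraph r).dualVisibilityCount i = r i := by
  have hfiber : Finset.univ.filter (fun j : BlockIndex r => j.1 = i) =
      Finset.univ.map (.sigmaMk i) := by
    ext ⟨i', x⟩
    simp only [Finset.mem_filter, Finset.mem_map, Finset.mem_univ, true_and]
    constructor
    · rintro rfl
      exact ⟨x, rfl⟩
    · rintro ⟨y, h⟩
      exact (congrArg Sigma.fst h).symm
  rw [dualVisibilityCount, dualMutualVisibilitySets_spectrumGraph hr0, Finset.filter_map,
    Finset.card_map]
  simp only [Function.comp_def, card_blockEmbedding, Fin.val_inj, hfiber, Finset.card_map,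
    Finset.card_univ, Fintype.card_fin]

end Spectrum

end DualVisibility

theorem theorem4p1 (k : ℕ) (r : Fin (k + 1) → ℕ) (hr0 : r 0 = 1)
    (hrk : 0 < r (Fin.last k)) :
    ∃ (V : Type) (_ : Fintype V) (G : SimpleGraph V), G.Connected ∧
      G.dualMutualVisibilityNumber = k ∧ G.dualVisibilitySpectrum = List.ofFn r := by
  have hk := DualVisibility.dualMutualVisibilityNumber_spectrumGraph hr0 hrk
  exact ⟨_, inferInstance, DualVisibility.spectrumGraph r,
    DualVisibility.shieldedBlockGraph_connected, hk,
    DualVisibility.dualVisibilitySpectrum_eq_ofFn hk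
      (DualVisibility.dualVisibilityCount_spectrumGraph hr0)⟩
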